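/- For $d\ge 1$, let $\mathbb{Z}_2^d$ be the group of $d$-tuples of integers modulo $2$. A set $E\subseteq\mathbb{Z}_2^d$ is *spectral* if there is a set $B\subseteq\mathbb{Z}_2^d$ such that the exponentials $e_b(x)=e^{2\pi i\,(b\cdot x)/2}=(-1)^{b\cdot x}$, $b\in B$, restricted to $E$, form an orthogonal basis of $L^2(E)$, the space of functions $E\to\mathbb{C}$ with $\langle f,g\rangle=\sum_{x\in E}f(x)\overline{g(x)}$. The set $E$ is a *tile* if there is a set $T\subseteq\mathbb{Z}_2^d$ such that every element of $\mathbb{Z}_2^d$ can be written in exactly one way as $x+t$ with $x\in E$ and $t\in T$. **Proposition.** Let $d=5$ or $d=6$, and let $E\subseteq\mathbb{Z}_2^d$ be a set whose size is a power of $2$ (that is, $|E|=2^k$ for some integer $k\ge 0$). Then $E$ is spectral if and only if $E$ is a tile. -/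

import Mathlib

open scoped ComplexConjugate

/-- The group `ℤ₂^d`. -/
abbrev Z2 (d : ℕ) : Type := Fin d → ZMod 2

/-- The exponential `e_b(x) = exp(2πi (b · x) / 2)` on `ℤ₂^d` with frequency `b`. -/
noncomputable def expo {d : ℕ} (b x : Z2 d) : ℂ := ZMod.stdAddChar (b ⬝ᵥ x)

/-- `B` is a spectrum of `E`: the restrictions to `E` of the exponentials with frequencies in `B`
form an orthogonal basis of `L²(E)`, the space of all complex functions on `E` with
`⟨f, g⟩ = ∑ x ∈ E, f x * conj (g x)`. -/
def IsSpectrum {d : ℕ} (E B : Finset (Z2 d)) : Prop :=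
  (∀ b ∈ B, ∀ b' ∈ B, b ≠ b' → ∑ x ∈ E, expo b x * conj (expo b' x) = 0) ∧
    Submodule.span ℂ ((fun (b : Z2 d) (x : E) => expo b (x : Z2 d)) '' (B : Set (Z2 d))) = ⊤

/-- `E` is spectral: it has a spectrum. -/
def IsSpectral {d : ℕ} (E : Finset (Z2 d)) : Prop :=
  ∃ B : Finset (Z2 d), IsSpectrum E B

/-- `E` is a tile: for some `T`, the translates `E + t`, `t ∈ T`, partition the group, that is,
every element is uniquely `x + t` with `x ∈ E` and `t ∈ T`. -/
def IsTile {d : ℕ} (E : Finset (Z2 d)) : Prop :=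
  ∃ T : Finset (Z2 d), ∀ g : Z2 d, ∃! p : Z2 d × Z2 d, p.1 ∈ E ∧ p.2 ∈ T ∧ p.1 + p.2 = g

/-! If a linear map `L` to `𝔽₂^k` is injective on a set `E` of size `2^k`, it is bijective there.
Then `ker L` is a tiling complement of `E`, and the image of the transpose of `L` is a spectrum. So
it suffices that each of the two properties yields such an `L`, for which a subspace of codimension
`k` containing no `x + y` with `x ≠ y` in `E` is enough.

For `k ≤ 2` such an `L` always exists. For `k = 3`, let `σ` be the sum of `E`. A parity count puts
the zeros of the transform of `1_E` in the hyperplane orthogonal to `σ`. Under either property this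
prevents `σ` from being a difference of distinct points of `E`, so modulo `σ` the set stays
injective and sums to zero; eight such points can be separated by hand. For `k ≥ d - 2` the subspace
has dimension at most two. It comes from differences of the tiling complement, or from frequencies
where the transform of the spectrum is nonzero. For `d ≤ 6` these ranges cover every `k`. -/

section Separating

variable {V : Type*} [AddCommGroup V] [Module (ZMod 2) V]

/-- Some linear map to `𝔽₂^k` is injective on `E`. -/
def IsSeparated (k : ℕ) (E : Finset V) : Prop :=
  ∃ L : V →ₗ[ZMod 2] (Fin k → ZMod 2), Set.InjOn L E

/-! ### Functionals over `𝔽₂`. -/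

theorem add_self_of_zmod_two (x : V) : x + x = 0 := by
  have h : (2 : ZMod 2) • x = x + x := two_smul _ x
  rw [← h, show (2 : ZMod 2) = 0 from rfl, zero_smul]

theorem add_eq_zero_iff_of_zmod_two {x y : V} : x + y = 0 ↔ x = y := by
  constructor
  · intro h
    have := add_self_of_zmod_two y
    exact add_right_cancel (h.trans this.symm)
  · rintro rfl
    exact add_self_of_zmod_two x

theorem exists_dual_eq_one {a : V} (ha : a ≠ 0) : ∃ f : V →ₗ[ZMod 2] ZMod 2, f a = 1 := by
  by_contra! h
  refine ha ((Module.forall_dual_apply_eq_zero_iff (ZMod 2) a).1 fun f => ?_)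
  have := h f
  generalize f a = t at *
  revert this
  revert t
  decide

/-- The functionals vanishing at `a` and those vanishing at `b` are proper subspaces of the dual,
and two proper subspaces never cover. -/
theorem exists_dual_eq_one_eq_one {a b : V} (ha : a ≠ 0) (hb : b ≠ 0) :
    ∃ f : V →ₗ[ZMod 2] ZMod 2, f a = 1 ∧ f b = 1 := by
  obtain ⟨f, hf⟩ := exists_dual_eq_one ha
  obtain ⟨g, hg⟩ := exists_dual_eq_one hb
  by_cases h1 : f b = 1
  · exact ⟨f, hf, h1⟩
  by_cases h2 : g a = 1
  · exact ⟨g, h2, hg⟩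
  have h0 : ∀ t : ZMod 2, t ≠ 1 → t = 0 := by decide
  exact ⟨f + g, by simp [hf, h0 _ h2], by simp [hg, h0 _ h1]⟩

/-! ### Separating at most four points. -/

theorem isSeparated_of_card_eq_one {E : Finset V} (h : E.card = 1) : IsSeparated 0 E := by
  obtain ⟨a, rfl⟩ := Finset.card_eq_one.1 h
  exact ⟨0, by simp⟩

theorem isSeparated_of_card_eq_two {E : Finset V} (h : E.card = 2) : IsSeparated 1 E := by
  classical
  obtain ⟨a, b, hab, rfl⟩ := Finset.card_eq_two.1 h
  obtain ⟨f, hf⟩ := exists_dual_eq_one (mt add_eq_zero_iff_of_zmod_two.1 hab)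
  refine ⟨LinearMap.pi ![f], ?_⟩
  have hne : f a ≠ f b := by
    rw [map_add] at hf
    generalize f a = s at *
    generalize f b = t at *
    revert s t
    decide
  intro x hx y hy hxy
  have hxy := congrFun hxy 0
  simp only [Finset.coe_insert, Finset.coe_singleton, Set.mem_insert_iff,
    Set.mem_singleton_iff] at hx hy
  simp only [LinearMap.pi_apply, Matrix.cons_val_zero] at hxy
  rcases hx with rfl | rfl <;> rcases hy with rfl | rfl <;> first | rfl | exact absurd hxy hne | exact absurd hxy.symm hne

/-- Two functionals tell apart `p, q, r, s` as soon as the first splits them as `{p, q}`, `{r, s}`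
and the second splits both pairs. -/
theorem isSeparated_of_splits [DecidableEq V] {p q r s : V} (f g : V →ₗ[ZMod 2] ZMod 2)
    (h1 : f p = f q) (h2 : f r = f s) (h3 : f p ≠ f r) (h4 : g p ≠ g q) (h5 : g r ≠ g s) :
    IsSeparated 2 ({p, q, r, s} : Finset V) := by
  refine ⟨LinearMap.pi ![f, g], ?_⟩
  intro x hx y hy hxy
  have hf := congrFun hxy 0
  have hg := congrFun hxy 1
  simp only [Finset.coe_insert, Finset.coe_singleton, Set.mem_insert_iff,
    Set.mem_singleton_iff] at hx hy
  simp only [LinearMap.pi_apply, Matrix.cons_val_zero, Matrix.cons_val_one] at hf hg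
  rcases hx with rfl | rfl | rfl | rfl <;> rcases hy with rfl | rfl | rfl | rfl <;>
    first | rfl | (exfalso; grind)

/-- A functional that splits both `{a, b}` and `{c, e}` cuts the set into two pairs, and a second
one can be chosen to split both of these. -/
theorem isSeparated_of_card_eq_four {E : Finset V} (h : E.card = 4) : IsSeparated 2 E := by
  classical
  obtain ⟨a, b, c, e, hab, hac, hae, hbc, hbe, hce, rfl⟩ := Finset.card_eq_four.1 h
  obtain ⟨f, hf, hf'⟩ := exists_dual_eq_one_eq_one (mt add_eq_zero_iff_of_zmod_two.1 hab)
    (mt add_eq_zero_iff_of_zmod_two.1 hce)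
  have key : ∀ s t : ZMod 2, s + t = 1 ↔ s ≠ t := by decide
  have two : ∀ r s t : ZMod 2, r ≠ s → s ≠ t → r = t := by decide
  rw [map_add, key] at hf hf'
  by_cases hc : f a = f c
  · obtain ⟨g, hg, hg'⟩ := exists_dual_eq_one_eq_one (mt add_eq_zero_iff_of_zmod_two.1 hac)
      (mt add_eq_zero_iff_of_zmod_two.1 hbe)
    rw [map_add, key] at hg hg'
    rw [show ({a, b, c, e} : Finset V) = {a, c, b, e} by grind]
    exact isSeparated_of_splits f g hc (two _ _ _ hf.symm (hc ▸ hf')) hf hg hg'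
  · obtain ⟨g, hg, hg'⟩ := exists_dual_eq_one_eq_one (mt add_eq_zero_iff_of_zmod_two.1 hae)
      (mt add_eq_zero_iff_of_zmod_two.1 hbc)
    rw [map_add, key] at hg hg'
    rw [show ({a, b, c, e} : Finset V) = {a, e, b, c} by grind]
    exact isSeparated_of_splits f g (two _ _ _ hc hf') (two _ _ _ hf.symm hc) hf hg hg'

/-! ### Passing to quotients. -/

theorem IsSeparated.of_comp {W : Type*} [AddCommGroup W] [Module (ZMod 2) W] [DecidableEq W]
    {k : ℕ} {E : Finset V} (φ : V →ₗ[ZMod 2] W) (hφ : Set.InjOn φ E)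
    (h : IsSeparated k (E.image φ)) : IsSeparated k E := by
  obtain ⟨L, hL⟩ := h
  refine ⟨L ∘ₗ φ, fun x hx y hy hxy => hφ hx hy (hL ?_ ?_ hxy)⟩
  · simpa using ⟨x, hx, rfl⟩
  · simpa using ⟨y, hy, rfl⟩

theorem injOn_mkQ_of_disjoint {E : Set V} (P : Submodule (ZMod 2) V)
    (h : ∀ x ∈ E, ∀ y ∈ E, x ≠ y → x + y ∉ P) : Set.InjOn P.mkQ E := by
  intro x hx y hy hxy
  by_contra hne
  refine h x hx y hy hne ?_
  have h1 : x - y ∈ P := (Submodule.Quotient.eq P).1 hxy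
  rwa [sub_eq_add_neg, neg_eq_of_add_eq_zero_left (add_self_of_zmod_two y)] at h1

theorem mem_span_singleton_zmod_two {x v : V} :
    x ∈ Submodule.span (ZMod 2) {v} ↔ x = 0 ∨ x = v := by
  rw [Submodule.mem_span_singleton]
  constructor
  · rintro ⟨c, rfl⟩
    have : c = 0 ∨ c = 1 := by revert c; decide
    rcases this with rfl | rfl <;> simp
  · rintro (rfl | rfl)
    exacts [⟨0, by simp⟩, ⟨1, by simp⟩]

theorem mem_span_pair_zmod_two {x u v : V} :
    x ∈ Submodule.span (ZMod 2) {u, v} ↔ x = 0 ∨ x = u ∨ x = v ∨ x = u + v := by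
  rw [Submodule.mem_span_pair]
  constructor
  · rintro ⟨c, e, rfl⟩
    have hc : c = 0 ∨ c = 1 := by revert c; decide
    have he : e = 0 ∨ e = 1 := by revert e; decide
    rcases hc with rfl | rfl <;> rcases he with rfl | rfl <;> simp
  · rintro (rfl | rfl | rfl | rfl)
    exacts [⟨0, 0, by simp⟩, ⟨1, 0, by simp⟩, ⟨0, 1, by simp⟩, ⟨1, 1, by simp⟩]

theorem injOn_mkQ_span_singleton {E : Set V} {v : V}
    (h : ∀ x ∈ E, ∀ y ∈ E, x ≠ y → x + y ≠ v) :
    Set.InjOn (Submodule.span (ZMod 2) {v}).mkQ E := by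
  refine injOn_mkQ_of_disjoint _ fun x hx y hy hne hmem => ?_
  rcases mem_span_singleton_zmod_two.1 hmem with h0 | h1
  · exact hne (add_eq_zero_iff_of_zmod_two.1 h0)
  · exact h x hx y hy hne h1

/-! ### Separating eight points. -/

/-- Two disjoint affine planes can be separated by three functionals. -/
theorem isSeparated_of_two_planes {E : Finset V} {p a w p' a' w' : V}
    {f : V →ₗ[ZMod 2] ZMod 2} (hw : w ≠ 0) (hw' : w' ≠ 0)
    (hfa : f a = 1) (hfw : f w = 0) (hfa' : f a' = 1) (hfw' : f w' = 0)
    (hE : ∀ x ∈ E, (∃ s t : ZMod 2, x = p + s • a + t • w) ∨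
      ∃ s t : ZMod 2, x = p' + s • a' + t • w')
    (hdisj : ∀ s t s' t' : ZMod 2, p + s • a + t • w ≠ p' + s' • a' + t' • w') :
    IsSeparated 3 E := by
  obtain ⟨g, hg, hg'⟩ := exists_dual_eq_one_eq_one hw hw'
  -- Disjointness of the planes says that their base points differ modulo the span of all four
  -- directions, so some `l` is constant on each plane and tells them apart.
  have hmem : p + p' ∉ Submodule.span (ZMod 2) {a, w, a', w'} := by
    intro hmem
    simp only [Submodule.mem_span_insert, Submodule.mem_span_singleton] at hmem
    obtain ⟨s, _, ⟨t, _, ⟨s', _, ⟨t', rfl⟩, rfl⟩, rfl⟩, h⟩ := hmem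
    refine hdisj s t s' t' ?_
    rw [← add_eq_zero_iff_of_zmod_two]
    calc p + s • a + t • w + (p' + s' • a' + t' • w')
        = (p + p') + (s • a + (t • w + (s' • a' + t' • w'))) := by abel
      _ = 0 := by rw [h, add_self_of_zmod_two]
  obtain ⟨l, hl, hker⟩ := Submodule.exists_le_ker_of_notMem hmem
  have hl0 : ∀ y ∈ ({a, w, a', w'} : Set V), l y = 0 := fun y hy =>
    hker (Submodule.subset_span hy)
  have hla := hl0 a (by simp)
  have hlw := hl0 w (by simp)
  have hla' := hl0 a' (by simp)
  have hlw' := hl0 w' (by simp)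
  have hlp : l p ≠ l p' := fun h => hl (by rw [map_add, h]; exact CharTwo.add_self_eq_zero _)
  -- Here `l` identifies the plane, `f` then determines the coefficient of `a` or `a'`, and `g` the
  -- remaining one.
  refine ⟨LinearMap.pi ![f, g, l], ?_⟩
  intro x hx y hy hxy
  have e1 := congrFun hxy 0
  have e2 := congrFun hxy 1
  have e3 := congrFun hxy 2
  simp only [LinearMap.pi_apply, Matrix.cons_val_zero, Matrix.cons_val_one,
    Matrix.cons_val] at e1 e2 e3
  rcases hE x hx with ⟨s, t, rfl⟩ | ⟨s, t, rfl⟩ <;>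
    rcases hE y hy with ⟨s', t', rfl⟩ | ⟨s', t', rfl⟩ <;>
    simp [hfa, hfw, hfa', hfw', hg, hg', hla, hla', hlw, hlw'] at e1 e2 e3
  · subst e1
    rw [add_left_cancel e2]
  · exact absurd e3 hlp
  · exact absurd e3.symm hlp
  · subst e1
    rw [add_left_cancel e2]

/-- A set of four vectors with sum zero is an affine plane, which can be given by a direction in
the kernel of a suitable functional and another direction. -/
theorem exists_plane_of_sum_eq_zero {F : Finset V} (hF : F.card = 4) (h0 : ∑ x ∈ F, x = 0) :
    ∃ p a b : V, a ≠ 0 ∧ b ≠ 0 ∧ a + b ≠ 0 ∧ (∀ x, x ∈ F ↔ ∃ s t : ZMod 2, x = p + s • a + t • b) := by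
  classical
  obtain ⟨x, y, z, u, hxy, hxz, hxu, hyz, hyu, hzu, rfl⟩ := Finset.card_eq_four.1 hF
  have hu : x + (y + (z + u)) = 0 := by
    rw [← h0]
    simp [Finset.sum_insert, hxy, hxz, hxu, hyz, hyu, hzu]
  have hu : u = x + y + z := by
    rw [eq_comm, ← add_eq_zero_iff_of_zmod_two, ← hu]
    abel
  have hx := add_self_of_zmod_two x
  refine ⟨x, x + y, x + z, mt add_eq_zero_iff_of_zmod_two.1 hxy,
    mt add_eq_zero_iff_of_zmod_two.1 hxz, ?_, ?_⟩
  · intro h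
    refine hyz (add_eq_zero_iff_of_zmod_two.1 ?_)
    rw [← h, show x + y + (x + z) = (x + x) + (y + z) by abel, hx, zero_add]
  · have e1 : x + (x + y) = y := by rw [← add_assoc, hx, zero_add]
    have e2 : x + (x + z) = z := by rw [← add_assoc, hx, zero_add]
    have e3 : y + (x + z) = u := by rw [hu]; abel
    have hex : ∀ P : ZMod 2 → Prop, (∃ s, P s) ↔ P 0 ∨ P 1 := fun P => Fin.exists_fin_two
    intro v
    simp only [hex, zero_smul, one_smul, add_zero, e1, e2, e3, Finset.mem_insert,
      Finset.mem_singleton]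
    tauto

/-- If `f b = 1`, then `a + b` lies in the kernel of `f` and spans the same plane with `a`. -/
theorem plane_change_basis {p a b : V} {f : V →ₗ[ZMod 2] ZMod 2} (hb : b ≠ 0) (hab : a + b ≠ 0)
    (hf : f a = 1) : ∃ w : V, w ≠ 0 ∧ f w = 0 ∧ ∀ x,
      (∃ s t : ZMod 2, x = p + s • a + t • b) ↔ ∃ s t : ZMod 2, x = p + s • a + t • w := by
  by_cases h : f b = 0
  · exact ⟨b, hb, h, fun x => Iff.rfl⟩
  · have h1 : f b = 1 := by
      generalize f b = t at *
      revert t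
      decide
    refine ⟨a + b, hab, by rw [map_add, hf, h1]; rfl, fun x => ⟨?_, ?_⟩⟩
    · rintro ⟨s, t, rfl⟩
      refine ⟨s + t, t, ?_⟩
      rw [smul_add, add_smul,
        show p + (s • a + t • a) + (t • a + t • b) = p + s • a + t • b + (t • a + t • a) by abel,
        add_self_of_zmod_two, add_zero]
    · rintro ⟨s, t, rfl⟩
      exact ⟨s + t, t, by rw [smul_add, add_smul]; abel⟩

/-- The complement of `F` also sums to zero, so `E` is a union of two disjoint affine planes. -/
theorem isSeparated_of_sum_subset_eq_zero [DecidableEq V] {E F : Finset V} (hE : E.card = 8)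
    (hE0 : ∑ x ∈ E, x = 0) (hFE : F ⊆ E) (hF : F.card = 4) (hF0 : ∑ x ∈ F, x = 0) :
    IsSeparated 3 E := by
  have hc : (E \ F).card = 4 := by rw [Finset.card_sdiff_of_subset hFE, hE, hF]
  have hc0 : ∑ x ∈ E \ F, x = 0 := by
    have := Finset.sum_sdiff (f := fun x => x) hFE
    rwa [hE0, hF0, add_zero] at this
  obtain ⟨p, a, b, ha, hb, hab, hpl⟩ := exists_plane_of_sum_eq_zero hF hF0
  obtain ⟨p', a', b', ha', hb', hab', hpl'⟩ := exists_plane_of_sum_eq_zero hc hc0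
  obtain ⟨f, hf, hf'⟩ := exists_dual_eq_one_eq_one ha ha'
  obtain ⟨w, hw, hfw, hch⟩ := plane_change_basis (p := p) hb hab hf
  obtain ⟨w', hw', hfw', hch'⟩ := plane_change_basis (p := p') hb' hab' hf'
  refine isSeparated_of_two_planes hw hw' hf hfw hf' hfw' (p := p) (p' := p') ?_ ?_
  · intro x hx
    rw [← hch, ← hch', ← hpl, ← hpl', Finset.mem_sdiff]
    tauto
  · intro s t s' t' h
    have h1 : p + s • a + t • w ∈ F := (hpl _).2 ((hch _).2 ⟨s, t, rfl⟩)
    have h2 : p + s • a + t • w ∈ E \ F := (hpl' _).2 ((hch' _).2 ⟨s', t', h⟩)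
    exact (Finset.mem_sdiff.1 h2).2 h1

theorem sum_ne_zero_of_card_eq_two {D : Finset V} (h : D.card = 2) : ∑ x ∈ D, x ≠ 0 := by
  classical
  obtain ⟨a, b, hab, rfl⟩ := Finset.card_eq_two.1 h
  rw [Finset.sum_pair hab]
  exact mt add_eq_zero_iff_of_zmod_two.1 hab

/-- If no four points sum to zero, factoring out the sum `v` of any four of them creates such a
quadruple, and `E` stays injective in the quotient. -/
theorem isSeparated_of_sum_eq_zero {E : Finset V} (hE : E.card = 8)
    (hE0 : ∑ x ∈ E, x = 0) : IsSeparated 3 E := by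
  classical
  by_cases hex : ∃ F ⊆ E, F.card = 4 ∧ ∑ x ∈ F, x = 0
  · obtain ⟨F, hFE, hF, hF0⟩ := hex
    exact isSeparated_of_sum_subset_eq_zero hE hE0 hFE hF hF0
  push Not at hex
  obtain ⟨F, hFE, hF⟩ := Finset.exists_subset_card_eq (show 4 ≤ E.card by omega)
  set v := ∑ x ∈ F, x with hv
  have hc : (E \ F).card = 4 := by rw [Finset.card_sdiff_of_subset hFE, hE, hF]
  have hcv : ∑ x ∈ E \ F, x = v := by
    have := Finset.sum_sdiff (f := fun x => x) hFE
    rwa [hE0, ← hv, add_eq_zero_iff_of_zmod_two] at this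
  -- a pair inside a block `D` of four elements with sum `v` leaves a pair with sum zero
  have hin : ∀ D : Finset V, D.card = 4 → ∑ x ∈ D, x = v → ∀ x ∈ D, ∀ y ∈ D, x ≠ y →
      x + y ≠ v := by
    intro D hD hDv x hx y hy hxy h
    have hsub : {x, y} ⊆ D := by grind
    refine sum_ne_zero_of_card_eq_two (D := D \ {x, y}) ?_ ?_
    · rw [Finset.card_sdiff_of_subset hsub, hD, Finset.card_pair hxy]
    · have := Finset.sum_sdiff (f := fun x => x) hsub
      rw [hDv, Finset.sum_pair hxy, h] at this
      exact add_right_cancel (this.trans (zero_add v).symm)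
  have hout : ∀ x ∈ F, ∀ y ∈ E \ F, x + y ≠ v := by
    intro x hx y hy h
    have hyF : y ∉ F.erase x := by grind
    -- Exchanging `x` for `y` changes the sum `v` of `F` by `x + y = v`, giving a forbidden
    -- quadruple with sum zero.
    refine hex (insert y (F.erase x)) (by grind) ?_ ?_
    · rw [Finset.card_insert_of_notMem hyF, Finset.card_erase_of_mem hx, hF]
    · have := Finset.add_sum_erase F (fun x => x) hx
      rw [Finset.sum_insert hyF]
      rw [← hv, ← h] at this
      rw [add_left_cancel this, add_self_of_zmod_two]
  have hne : ∀ x ∈ (E : Set V), ∀ y ∈ (E : Set V), x ≠ y → x + y ≠ v := by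
    intro x hx y hy hxy
    by_cases hxF : x ∈ F <;> by_cases hyF : y ∈ F
    · exact hin F hF rfl x hxF y hyF hxy
    · exact hout x hxF y (by grind)
    · rw [add_comm]
      exact hout y hyF x (by grind)
    · exact hin (E \ F) hc hcv x (by grind) y (by grind) hxy
  have hinj := injOn_mkQ_span_singleton hne
  refine IsSeparated.of_comp _ hinj (isSeparated_of_sum_subset_eq_zero (F := F.image _) ?_ ?_
    (Finset.image_subset_image hFE) ?_ ?_)
  · rw [Finset.card_image_of_injOn hinj, hE]
  · rw [Finset.sum_image hinj, ← map_sum, hE0, map_zero]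
  · rw [Finset.card_image_of_injOn (hinj.mono (by simpa using hFE)), hF]
  · rw [Finset.sum_image (hinj.mono (by simpa using hFE)), ← map_sum, ← hv]
    simp

theorem isSeparated_of_sum_notMem {E : Finset V} (hE : E.card = 8)
    (h : ∀ x ∈ E, ∀ y ∈ E, x ≠ y → x + y ≠ ∑ z ∈ E, z) : IsSeparated 3 E := by
  classical
  have hinj := injOn_mkQ_span_singleton (E := (E : Set V)) h
  refine IsSeparated.of_comp _ hinj (isSeparated_of_sum_eq_zero ?_ ?_)
  · rw [Finset.card_image_of_injOn hinj, hE]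
  · rw [Finset.sum_image hinj, ← map_sum]
    exact (Submodule.Quotient.mk_eq_zero _).2 (Submodule.mem_span_singleton_self _)

/-! ### Separation from a subspace that avoids differences. -/

theorem isSeparated_of_submodule [Module.Finite (ZMod 2) V] {E : Finset V} {k : ℕ}
    (P : Submodule (ZMod 2) V) (hP : Module.finrank (ZMod 2) P + k = Module.finrank (ZMod 2) V)
    (h : ∀ x ∈ E, ∀ y ∈ E, x ≠ y → x + y ∉ P) : IsSeparated k E := by
  have hk : Module.finrank (ZMod 2) (V ⧸ P) = k := by
    have := P.finrank_quotient_add_finrank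
    omega
  let e := (Module.finBasisOfFinrankEq (ZMod 2) (V ⧸ P) hk).equivFun
  refine ⟨e.toLinearMap ∘ₗ P.mkQ, ?_⟩
  intro x hx y hy hxy
  exact injOn_mkQ_of_disjoint (E := (E : Set V)) P h hx hy (e.injective hxy)

theorem isSeparated_of_ne_zero [Module.Finite (ZMod 2) V] {E : Finset V} {k : ℕ}
    (hk : 1 + k = Module.finrank (ZMod 2) V) {u : V} (hu : u ≠ 0)
    (h : ∀ x ∈ E, ∀ y ∈ E, x ≠ y → x + y ≠ u) : IsSeparated k E := by
  refine isSeparated_of_submodule (Submodule.span (ZMod 2) {u}) ?_ ?_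
  · rw [finrank_span_singleton hu, hk]
  · intro x hx y hy hne hmem
    rcases mem_span_singleton_zmod_two.1 hmem with h0 | h1
    · exact hne (add_eq_zero_iff_of_zmod_two.1 h0)
    · exact h x hx y hy hne h1

theorem isSeparated_of_plane [Module.Finite (ZMod 2) V] {E : Finset V} {k : ℕ}
    (hk : 2 + k = Module.finrank (ZMod 2) V) {u v : V} (hu : u ≠ 0) (hv : v ≠ 0)
    (huv : u ≠ v) (h : ∀ x ∈ E, ∀ y ∈ E, x ≠ y → x + y ≠ u ∧ x + y ≠ v ∧ x + y ≠ u + v) :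
    IsSeparated k E := by
  refine isSeparated_of_submodule (Submodule.span (ZMod 2) {u, v}) ?_ ?_
  · have hli : LinearIndependent (ZMod 2) ![u, v] := by
      rw [LinearIndependent.pair_iff]
      intro s t hst
      have hs : s = 0 ∨ s = 1 := by clear hst; revert s; decide
      have ht : t = 0 ∨ t = 1 := by clear hst; revert t; decide
      rcases hs with rfl | rfl <;> rcases ht with rfl | rfl <;>
        simp_all [add_eq_zero_iff_of_zmod_two]
    have := finrank_span_eq_card hli
    rw [Matrix.range_cons, Matrix.range_cons, Matrix.range_empty, Set.union_empty,
      Set.singleton_union] at this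
    rw [this, Fintype.card_fin, hk]
  · intro x hx y hy hne hmem
    obtain ⟨h1, h2, h3⟩ := h x hx y hy hne
    rcases mem_span_pair_zmod_two.1 hmem with h0 | h0 | h0 | h0
    exacts [hne (add_eq_zero_iff_of_zmod_two.1 h0), h1 h0, h2 h0, h3 h0]

end Separating

/-! ### Characters and Fourier transforms. -/

/-- The integer sign `(-1)^(b · x)`. -/
def sgn {d : ℕ} (b x : Z2 d) : ℤ := if b ⬝ᵥ x = 0 then 1 else -1

/-- The Fourier transform of the indicator function of `E`. -/
def charSum {d : ℕ} (E : Finset (Z2 d)) (b : Z2 d) : ℤ := ∑ x ∈ E, sgn b x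

section Fourier

variable {d : ℕ}

theorem expo_eq_sgn (b x : Z2 d) : expo b x = (sgn b x : ℂ) := by
  have h1 : (ZMod.stdAddChar (1 : ZMod 2) : ℂ) = -1 := by
    have hsq : (ZMod.stdAddChar (1 : ZMod 2) : ℂ) * ZMod.stdAddChar (1 : ZMod 2) = 1 := by
      rw [← AddChar.map_add_eq_mul, show (1 : ZMod 2) + 1 = 0 from rfl, AddChar.map_zero_eq_one]
    rcases mul_self_eq_one_iff.1 hsq with h | h
    · rw [← AddChar.map_zero_eq_one (ZMod.stdAddChar (N := 2))] at h
      exact absurd (ZMod.injective_stdAddChar h) (by decide)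
    · exact h
  unfold expo sgn
  generalize b ⬝ᵥ x = t
  have ht : t = 0 ∨ t = 1 := by revert t; decide
  rcases ht with rfl | rfl
  · simp
  · rw [h1]
    simp

theorem sgn_comm (b x : Z2 d) : sgn b x = sgn x b := by
  rw [sgn, sgn, dotProduct_comm]

theorem sgn_zero_left (x : Z2 d) : sgn 0 x = 1 := by
  simp [sgn]

theorem sgn_add_right (b x y : Z2 d) : sgn b (x + y) = sgn b x * sgn b y := by
  unfold sgn
  rw [dotProduct_add]
  generalize b ⬝ᵥ x = s
  generalize b ⬝ᵥ y = t
  revert s t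
  decide

theorem sgn_add_left (b c x : Z2 d) : sgn (b + c) x = sgn b x * sgn c x := by
  rw [sgn_comm, sgn_add_right, sgn_comm x, sgn_comm x]

theorem sgn_mul_self (b x : Z2 d) : sgn b x * sgn b x = 1 := by
  unfold sgn
  split_ifs <;> rfl

theorem sum_sgn (b : Z2 d) : ∑ x, sgn b x = if b = 0 then 2 ^ d else 0 := by
  split_ifs with h
  · subst h
    simp [sgn_zero_left]
  · obtain ⟨i, hi⟩ := Function.ne_iff.1 h
    have hs : sgn b (Pi.single i 1) = -1 := by
      unfold sgn
      rw [dotProduct_single_one]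
      exact if_neg hi
    have := Equiv.sum_comp (Equiv.addRight (Pi.single i (1 : ZMod 2))) (sgn b)
    simp only [Equiv.coe_addRight, sgn_add_right, hs, ← Finset.sum_mul] at this
    linarith

theorem sum_expo_mul_conj (E : Finset (Z2 d)) (b c : Z2 d) :
    ∑ x ∈ E, expo b x * conj (expo c x) = (charSum E (b + c) : ℂ) := by
  simp only [charSum, expo_eq_sgn, map_intCast, sgn_add_left]
  push_cast
  rfl

theorem charSum_zero (E : Finset (Z2 d)) : charSum E 0 = E.card := by
  simp [charSum, sgn_zero_left]

theorem sum_charSum_mul_sgn (E : Finset (Z2 d)) (x : Z2 d) :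
    ∑ b, charSum E b * sgn b x = if x ∈ E then 2 ^ d else 0 := by
  calc ∑ b, charSum E b * sgn b x = ∑ y ∈ E, ∑ b, sgn (y + x) b := by
        simp only [charSum, Finset.sum_mul]
        rw [Finset.sum_comm]
        refine Finset.sum_congr rfl fun y _ => Finset.sum_congr rfl fun b _ => ?_
        rw [sgn_comm (y + x), sgn_add_right]
    _ = ∑ y ∈ E, if x = y then 2 ^ d else 0 := by
        refine Finset.sum_congr rfl fun y _ => ?_
        rw [sum_sgn]
        exact if_congr (by rw [add_eq_zero_iff_of_zmod_two, eq_comm]) rfl rfl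
    _ = _ := Finset.sum_ite_eq _ _ _

/-- This is the Fourier form of `1_B * 1_B = 1_B` (pointwise product). -/
theorem sum_charSum_mul_charSum_add (B : Finset (Z2 d)) (n : Z2 d) :
    ∑ a, charSum B a * charSum B (a + n) = 2 ^ d * charSum B n := by
  calc ∑ a, charSum B a * charSum B (a + n)
      = ∑ x ∈ B, (∑ a, charSum B a * sgn a x) * sgn n x := by
        simp only [Finset.sum_mul]
        rw [Finset.sum_comm]
        refine Finset.sum_congr rfl fun a _ => ?_
        rw [charSum.eq_def B (a + n), Finset.mul_sum]
        refine Finset.sum_congr rfl fun x _ => ?_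
        rw [sgn_add_left]
        ring
    _ = ∑ x ∈ B, 2 ^ d * sgn n x := by
        refine Finset.sum_congr rfl fun x hx => ?_
        rw [sum_charSum_mul_sgn, if_pos hx]
    _ = _ := by rw [charSum, Finset.mul_sum]

/-- If `b` takes the value `1` an odd number of times on `E`, it is not balanced on `E`. -/
theorem charSum_ne_zero_of_dotProduct_sum {E : Finset (Z2 d)} (hE : 4 ∣ E.card) {b : Z2 d}
    (hb : b ⬝ᵥ (∑ x ∈ E, x) ≠ 0) : charSum E b ≠ 0 := by
  have h1 : b ⬝ᵥ (∑ x ∈ E, x) = ((E.filter fun x => b ⬝ᵥ x ≠ 0).card : ZMod 2) := by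
    rw [dotProduct_sum, Finset.card_filter]
    push_cast
    refine Finset.sum_congr rfl fun x _ => ?_
    generalize b ⬝ᵥ x = t
    revert t
    decide
  have h2 : charSum E b = E.card - 2 * (E.filter fun x => b ⬝ᵥ x ≠ 0).card := by
    rw [Finset.card_filter, Finset.card_eq_sum_ones]
    push_cast
    rw [Finset.mul_sum, ← Finset.sum_sub_distrib]
    refine Finset.sum_congr rfl fun x _ => ?_
    unfold sgn
    split_ifs <;> simp_all
  -- The transform is a multiple of 4 minus twice an odd number, hence `2` modulo `4`.
  rw [h1, ne_eq, ZMod.natCast_eq_zero_iff] at hb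
  rw [h2]
  omega

/-! ### Tilings. -/

/-- Tiling means that the convolution of `1_E` and `1_T` is the constant `1`. -/
theorem charSum_mul_charSum_of_tiling {E T : Finset (Z2 d)}
    (h : ∀ g : Z2 d, ∃! p : Z2 d × Z2 d, p.1 ∈ E ∧ p.2 ∈ T ∧ p.1 + p.2 = g) (b : Z2 d) :
    charSum E b * charSum T b = if b = 0 then 2 ^ d else 0 := by
  rw [← sum_sgn, charSum, charSum, Finset.sum_mul_sum, ← Finset.sum_product']
  refine Finset.sum_bij (fun p _ => p.1 + p.2) (fun _ _ => Finset.mem_univ _) ?_ ?_ ?_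
  · intro p hp q hq hpq
    rw [Finset.mem_product] at hp hq
    exact (h (q.1 + q.2)).unique ⟨hp.1, hp.2, hpq⟩ ⟨hq.1, hq.2, rfl⟩
  · intro g _
    obtain ⟨p, hp, -⟩ := h g
    exact ⟨p, Finset.mem_product.2 ⟨hp.1, hp.2.1⟩, hp.2.2⟩
  · intro p _
    rw [sgn_add_right]

theorem card_mul_card_of_tiling {E T : Finset (Z2 d)}
    (h : ∀ g : Z2 d, ∃! p : Z2 d × Z2 d, p.1 ∈ E ∧ p.2 ∈ T ∧ p.1 + p.2 = g) :
    E.card * T.card = 2 ^ d := by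
  have := charSum_mul_charSum_of_tiling h 0
  rw [charSum_zero, charSum_zero, if_pos rfl] at this
  exact_mod_cast this

theorem add_ne_add_of_tiling {E T : Finset (Z2 d)}
    (h : ∀ g : Z2 d, ∃! p : Z2 d × Z2 d, p.1 ∈ E ∧ p.2 ∈ T ∧ p.1 + p.2 = g) {x y s t : Z2 d}
    (hx : x ∈ E) (hy : y ∈ E) (hs : s ∈ T) (ht : t ∈ T) (hxy : x ≠ y) : x + y ≠ s + t := by
  intro heq
  have h1 : x + s = y + t := by
    rw [← add_eq_zero_iff_of_zmod_two, show x + s + (y + t) = (x + y) + (s + t) by abel, heq,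
      add_self_of_zmod_two]
  exact hxy (congrArg Prod.fst
    ((h (y + t)).unique (y₁ := (x, s)) (y₂ := (y, t)) ⟨hx, hs, h1⟩ ⟨hy, ht, rfl⟩))

theorem sum_ne_of_isTile {E : Finset (Z2 d)} (hE : 4 ∣ E.card) (h : IsTile E) :
    ∀ x ∈ E, ∀ y ∈ E, x ≠ y → x + y ≠ ∑ z ∈ E, z := by
  obtain ⟨T, h⟩ := h
  intro x hx y hy hxy heq
  have hT : T.Nonempty := by
    obtain ⟨p, hp, -⟩ := h 0
    exact ⟨p.2, hp.2.1⟩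
  obtain ⟨t, ht⟩ := hT
  -- the transform of `T` lives on the hyperplane orthogonal to the sum, so `T` is periodic
  have hper : ∑ b, charSum T b * sgn b (t + ∑ z ∈ E, z) = ∑ b, charSum T b * sgn b t := by
    refine Finset.sum_congr rfl fun b _ => ?_
    rw [sgn_add_right]
    by_cases hb : b ⬝ᵥ (∑ z ∈ E, z) = 0
    · rw [sgn.eq_def b (∑ z ∈ E, z), if_pos hb, mul_one]
    · have hb0 : b ≠ 0 := by
        rintro rfl
        exact hb (zero_dotProduct _)
      have := charSum_mul_charSum_of_tiling h b
      rw [if_neg hb0] at this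
      rw [(mul_eq_zero.1 this).resolve_left (charSum_ne_zero_of_dotProduct_sum hE hb), zero_mul,
        zero_mul]
  rw [sum_charSum_mul_sgn, sum_charSum_mul_sgn, if_pos ht] at hper
  have hmem : t + ∑ z ∈ E, z ∈ T := by
    by_contra hn
    rw [if_neg hn] at hper
    exact absurd hper (by positivity)
  refine add_ne_add_of_tiling h hx hy ht hmem hxy ?_
  rw [heq, ← add_assoc, add_self_of_zmod_two, zero_add]

/-! ### Spectra. -/

theorem IsSpectrum.charSum_eq_zero {E B : Finset (Z2 d)} (h : IsSpectrum E B) {b c : Z2 d}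
    (hb : b ∈ B) (hc : c ∈ B) (hbc : b ≠ c) : charSum E (b + c) = 0 := by
  have := h.1 b hb c hc hbc
  rw [sum_expo_mul_conj] at this
  exact_mod_cast this

/-- Expansion of a function on `E` in the orthogonal basis. -/
theorem IsSpectrum.expansion {E B : Finset (Z2 d)} (h : IsSpectrum E B) (f : E → ℂ) (x : E) :
    (E.card : ℂ) * f x = ∑ b ∈ B, (∑ z : E, f z * sgn b z) * sgn b x := by
  have hf : f ∈ Submodule.span ℂ ((fun (b : Z2 d) (x : E) => expo b (x : Z2 d)) '' (B : Set (Z2 d))) := by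
    rw [h.2]
    trivial
  induction hf using Submodule.span_induction with
  | mem f hf =>
    obtain ⟨c, hc, rfl⟩ := hf
    have key : ∀ b ∈ B, (∑ z : E, expo c z * (sgn b z : ℂ)) * sgn b x
        = if c = b then (E.card : ℂ) * expo c x else 0 := by
      intro b hb
      have h1 : (∑ z : E, expo c z * (sgn b z : ℂ)) = (charSum E (c + b) : ℂ) := by
        rw [← sum_expo_mul_conj, ← Finset.sum_coe_sort E fun x => expo c x * conj (expo b x)]
        simp only [expo_eq_sgn, map_intCast]
      rw [h1]
      split_ifs with hcb
      · subst hcb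
        rw [add_self_of_zmod_two, charSum_zero, expo_eq_sgn]
        simp
      · rw [h.charSum_eq_zero hc hb hcb]
        simp
    rw [Finset.sum_congr rfl key, Finset.sum_ite_eq, if_pos (Finset.mem_coe.1 hc)]
  | zero => simp
  | add f g _ _ hf hg =>
    simp only [Pi.add_apply, mul_add, add_mul, Finset.sum_add_distrib, hf, hg]
  | smul a f _ hf =>
    simp only [Pi.smul_apply, smul_eq_mul]
    rw [mul_left_comm, hf, Finset.mul_sum]
    refine Finset.sum_congr rfl fun b _ => ?_
    rw [← mul_assoc, Finset.mul_sum]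
    simp only [mul_assoc]

/-- Duality: orthogonality of the rows of the sign matrix on `B × E` passes to its columns. It is
read off by expanding the point mass at `y` and evaluating at `x`. -/
theorem IsSpectrum.charSum_add {E B : Finset (Z2 d)} (h : IsSpectrum E B) {x y : Z2 d}
    (hx : x ∈ E) (hy : y ∈ E) : charSum B (x + y) = if x = y then (E.card : ℤ) else 0 := by
  have := h.expansion (Pi.single ⟨y, hy⟩ 1) ⟨x, hx⟩
  have h1 : ∀ b : Z2 d, ∑ z : E, (Pi.single (⟨y, hy⟩ : E) (1 : ℂ) : E → ℂ) z * (sgn b z : ℂ)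
      = sgn b y := by
    intro b
    rw [Finset.sum_eq_single ⟨y, hy⟩]
    · simp
    · intro z _ hz
      simp [hz]
    · simp
  simp only [h1] at this
  simp only [Pi.single_apply, Subtype.mk.injEq] at this
  have h2 : (E.card : ℤ) * (if x = y then 1 else 0) = ∑ b ∈ B, sgn b y * sgn b x := by
    exact_mod_cast this
  rw [charSum, mul_ite, mul_one, mul_zero] at *
  rw [h2]
  refine Finset.sum_congr rfl fun b _ => ?_
  rw [sgn_comm, sgn_add_right, mul_comm]

theorem IsSpectrum.card_eq {E B : Finset (Z2 d)} (h : IsSpectrum E B) (hE : E.Nonempty) :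
    B.card = E.card := by
  obtain ⟨x, hx⟩ := hE
  have := h.charSum_add hx hx
  rw [add_self_of_zmod_two, if_pos rfl, charSum_zero] at this
  exact_mod_cast this

/-- All differences of `B` are orthogonal to the sum of `E`, so its sign is constant on `B` and the
transform of `B` there is `±|B|`. That transform vanishes at differences of distinct points of `E`.
-/
theorem sum_ne_of_isSpectral {E : Finset (Z2 d)} (hE : 4 ∣ E.card) (h : IsSpectral E) :
    ∀ x ∈ E, ∀ y ∈ E, x ≠ y → x + y ≠ ∑ z ∈ E, z := by
  obtain ⟨B, h⟩ := h
  intro x hx y hy hxy heq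
  have hBE := h.card_eq ⟨x, hx⟩
  have hpos : 0 < E.card := Finset.card_pos.2 ⟨x, hx⟩
  obtain ⟨c, hc⟩ : B.Nonempty := Finset.card_pos.1 (by omega)
  have hconst : ∀ b ∈ B, sgn (x + y) b = sgn (x + y) c := by
    intro b hb
    by_cases hbc : b = c
    · rw [hbc]
    have h0 := h.charSum_eq_zero hb hc hbc
    have hdot : (b + c) ⬝ᵥ (x + y) = 0 := by
      by_contra hn
      rw [heq] at hn
      exact charSum_ne_zero_of_dotProduct_sum hE hn h0
    have h1 : sgn (x + y) b * sgn (x + y) c = 1 := by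
      rw [← sgn_add_right, sgn_comm, sgn, if_pos hdot]
    calc sgn (x + y) b = sgn (x + y) b * (sgn (x + y) c * sgn (x + y) c) := by
          rw [sgn_mul_self, mul_one]
      _ = _ := by rw [← mul_assoc, h1, one_mul]
  have h0 := h.charSum_add hx hy
  rw [if_neg hxy, charSum, Finset.sum_congr rfl hconst, Finset.sum_const, nsmul_eq_mul, hBE] at h0
  rcases mul_eq_zero.1 h0 with h1 | h1
  · omega
  · have := sgn_mul_self (x + y) c
    rw [h1] at this
    exact absurd this (by decide)

/-! ### Sets of index two and four. -/

/-- Otherwise Parseval would reduce to `|B|^2 = 2^d |B|`. -/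
theorem exists_charSum_ne_zero {B : Finset (Z2 d)} (hB : B.Nonempty) (hlt : B.card < 2 ^ d) :
    ∃ n ≠ 0, charSum B n ≠ 0 := by
  by_contra! hn
  have h := sum_charSum_mul_charSum_add B 0
  rw [Finset.sum_eq_single 0 (fun a _ ha => by rw [hn a ha, zero_mul]) (by simp), add_zero,
    charSum_zero] at h
  have hpos : (B.card : ℤ) ≠ 0 := by exact_mod_cast (Finset.card_pos.2 hB).ne'
  have h2 := mul_right_cancel₀ hpos h
  exact hlt.ne (by exact_mod_cast h2)

theorem isSeparated_of_isSpectral_index_two {E : Finset (Z2 d)} {k : ℕ} (hk : 1 + k = d)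
    (hE : E.card = 2 ^ k) (h : IsSpectral E) : IsSeparated k E := by
  obtain ⟨B, h⟩ := h
  have hne : E.Nonempty := Finset.card_pos.1 (by rw [hE]; positivity)
  have hB := h.card_eq hne
  have hBne : B.Nonempty := Finset.card_pos.1 (by rw [hB, hE]; positivity)
  obtain ⟨n, hn, hn'⟩ := exists_charSum_ne_zero hBne
    (by rw [hB, hE]; exact Nat.pow_lt_pow_right one_lt_two (by omega))
  refine isSeparated_of_ne_zero (by simpa using hk) hn fun x hx y hy hxy heq => hn' ?_
  rw [← heq, h.charSum_add hx hy, if_neg hxy]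

theorem isSeparated_of_isSpectral_index_four {E : Finset (Z2 d)} {k : ℕ} (hk : 2 + k = d)
    (hE : E.card = 2 ^ k) (h : IsSpectral E) : IsSeparated k E := by
  obtain ⟨B, h⟩ := h
  have hne : E.Nonempty := Finset.card_pos.1 (by rw [hE]; positivity)
  have hB := h.card_eq hne
  have hBne : B.Nonempty := Finset.card_pos.1 (by rw [hB, hE]; positivity)
  obtain ⟨n, hn, hn'⟩ := exists_charSum_ne_zero hBne
    (by rw [hB, hE]; exact Nat.pow_lt_pow_right one_lt_two (by omega))
  -- This provides a plane `{0, a, n, a + n}` on which the transform of `B` never vanishes. If only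
  -- `a = 0` and `a = n` contributed to the autocorrelation at `n`, it would be `2 * 2^k` times the
  -- transform at `n`, instead of `2^d = 4 * 2^k` times.
  have hex : ∃ a, a ≠ 0 ∧ a ≠ n ∧ charSum B a ≠ 0 ∧ charSum B (a + n) ≠ 0 := by
    by_contra! hcon
    have h1 := sum_charSum_mul_charSum_add B n
    rw [Finset.sum_eq_add (0 : Z2 d) n hn.symm (fun a _ ha => by
        by_cases h0 : charSum B a = 0
        · rw [h0, zero_mul]
        · rw [hcon a ha.1 ha.2 h0, mul_zero]) (by simp) (by simp),
      add_self_of_zmod_two, zero_add, charSum_zero, hB, hE,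
      show (2 : ℤ) ^ d = 2 ^ 2 * 2 ^ k by rw [← hk, pow_add]] at h1
    have h2 : (2 : ℤ) ^ k * charSum B n = 0 := by
      push_cast at h1
      linarith
    exact mul_ne_zero (by positivity) hn' h2
  obtain ⟨a, ha, han, ha1, ha2⟩ := hex
  have hav : ∀ m, charSum B m ≠ 0 → ∀ x ∈ E, ∀ y ∈ E, x ≠ y → x + y ≠ m := by
    intro m hm x hx y hy hxy heq
    exact hm (by rw [← heq, h.charSum_add hx hy, if_neg hxy])
  exact isSeparated_of_plane (by simpa using hk) ha hn han fun x hx y hy hxy =>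
    ⟨hav _ ha1 x hx y hy hxy, hav _ hn' x hx y hy hxy, hav _ ha2 x hx y hy hxy⟩

theorem isSeparated_of_isTile_index_two {E : Finset (Z2 d)} {k : ℕ} (hk : 1 + k = d)
    (hE : E.card = 2 ^ k) (h : IsTile E) : IsSeparated k E := by
  obtain ⟨T, h⟩ := h
  have hT : T.card = 2 := by
    have := card_mul_card_of_tiling h
    rw [hE, show 2 ^ d = 2 ^ k * 2 by rw [← hk, pow_add, mul_comm, pow_one]] at this
    exact Nat.eq_of_mul_eq_mul_left (by positivity) this
  obtain ⟨s, t, hst, rfl⟩ := Finset.card_eq_two.1 hT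
  exact isSeparated_of_ne_zero (by simpa using hk) (mt add_eq_zero_iff_of_zmod_two.1 hst)
    fun x hx y hy hxy => add_ne_add_of_tiling h hx hy (by simp) (by simp) hxy

theorem isSeparated_of_isTile_index_four {E : Finset (Z2 d)} {k : ℕ} (hk : 2 + k = d)
    (hE : E.card = 2 ^ k) (h : IsTile E) : IsSeparated k E := by
  obtain ⟨T, h⟩ := h
  have hT : T.card = 4 := by
    have := card_mul_card_of_tiling h
    rw [hE, show 2 ^ d = 2 ^ k * 4 by rw [← hk, pow_add, mul_comm]; rfl] at this
    exact Nat.eq_of_mul_eq_mul_left (by positivity) this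
  obtain ⟨s, t, u, v, hst, hsu, -, htu, -, -, rfl⟩ := Finset.card_eq_four.1 hT
  -- The plane spanned by `s + t` and `s + u` consists of differences of `T`, so it contains no
  -- nonzero difference of `E`.
  have hadd : s + t + (s + u) = t + u := by
    rw [show s + t + (s + u) = s + s + (t + u) by abel, add_self_of_zmod_two, zero_add]
  refine isSeparated_of_plane (by simpa using hk) (mt add_eq_zero_iff_of_zmod_two.1 hst)
    (mt add_eq_zero_iff_of_zmod_two.1 hsu) (fun he => htu (add_left_cancel he))
    fun x hx y hy hxy => ⟨?_, ?_, ?_⟩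
  · exact add_ne_add_of_tiling h hx hy (by simp) (by simp) hxy
  · exact add_ne_add_of_tiling h hx hy (by simp) (by simp) hxy
  · rw [hadd]
    exact add_ne_add_of_tiling h hx hy (by simp) (by simp) hxy

/-! ### From separation to tiles and spectra. -/

theorem isSeparated_self {E : Finset (Z2 d)} : IsSeparated d E :=
  ⟨LinearMap.id, fun _ _ _ _ h => h⟩

theorem image_eq_univ_of_injOn {k : ℕ} {E : Finset (Z2 d)} (hE : E.card = 2 ^ k)
    {L : Z2 d →ₗ[ZMod 2] Z2 k} (hL : Set.InjOn L E) : E.image L = Finset.univ := by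
  refine Finset.eq_univ_of_card _ ?_
  rw [Finset.card_image_of_injOn hL, hE]
  simp

theorem IsSeparated.isTile {k : ℕ} {E : Finset (Z2 d)} (hE : E.card = 2 ^ k)
    (h : IsSeparated k E) : IsTile E := by
  obtain ⟨L, hL⟩ := h
  have himg := image_eq_univ_of_injOn hE hL
  refine ⟨Finset.univ.filter fun x => L x = 0, fun g => ?_⟩
  obtain ⟨x, hx, hxg⟩ := Finset.mem_image.1 (himg ▸ Finset.mem_univ (L g))
  refine ⟨(x, g - x), ⟨hx, by simp [hxg], add_sub_cancel _ _⟩, ?_⟩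
  rintro ⟨y, t⟩ ⟨hy, ht, rfl⟩
  have ht : L t = 0 := by simpa using ht
  obtain rfl : y = x := hL hy hx (by rw [hxg, map_add, ht, add_zero])
  simp

theorem IsSeparated.isSpectral {k : ℕ} {E : Finset (Z2 d)} (hE : E.card = 2 ^ k)
    (h : IsSeparated k E) : IsSpectral E := by
  obtain ⟨L, hL⟩ := h
  have himg := image_eq_univ_of_injOn hE hL
  -- The transpose of `L`: it pulls the characters of `𝔽₂^k` back to `E`.
  let φ : Z2 k → Z2 d := fun c => Matrix.vecMul c (LinearMap.toMatrix' L)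
  have hφ : ∀ c x, sgn (φ c) x = sgn c (L x) := by
    intro c x
    unfold sgn
    rw [← Matrix.dotProduct_mulVec, LinearMap.toMatrix'_mulVec]
  refine ⟨Finset.univ.image φ, ?_, ?_⟩
  · intro b hb b' hb' hne
    obtain ⟨c, -, rfl⟩ := Finset.mem_image.1 hb
    obtain ⟨c', -, rfl⟩ := Finset.mem_image.1 hb'
    have hcc : c + c' ≠ 0 := by
      rw [ne_eq, add_eq_zero_iff_of_zmod_two]
      rintro rfl
      exact hne rfl
    have hs : charSum E (φ c + φ c') = 0 := by
      calc charSum E (φ c + φ c') = ∑ x ∈ E, sgn (c + c') (L x) := by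
            refine Finset.sum_congr rfl fun x _ => ?_
            rw [sgn_add_left, sgn_add_left, hφ, hφ]
        _ = ∑ y, sgn (c + c') y := by rw [← himg, Finset.sum_image hL]
        _ = 0 := by rw [sum_sgn, if_neg hcc]
    rw [sum_expo_mul_conj, hs, Int.cast_zero]
  · rw [eq_top_iff]
    intro f _
    have hsum : f = ∑ y : E, f y • (Pi.single y 1 : E → ℂ) := by
      simpa using pi_eq_sum_univ' f
    rw [hsum]
    refine Submodule.sum_mem _ fun y _ => Submodule.smul_mem _ _ ?_
    -- Fourier inversion on `𝔽₂^k`, transported to `E` by the bijection `L`, writes each point mass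
    -- as a combination of exponentials.
    have hdelta : (Pi.single y 1 : E → ℂ)
        = (2 ^ k : ℂ)⁻¹ • ∑ c, (sgn (φ c) y : ℂ) • fun x : E => expo (φ c) (x : Z2 d) := by
      funext x
      have hc : ∑ c, sgn (φ c) y * sgn (φ c) x = if x = y then 2 ^ k else 0 := by
        calc ∑ c, sgn (φ c) y * sgn (φ c) x = ∑ c, sgn (L y + L x) c := by
              refine Finset.sum_congr rfl fun c _ => ?_
              rw [hφ, hφ, sgn_comm (L y + L x), sgn_add_right]
          _ = _ := by
              rw [sum_sgn]
              refine if_congr ?_ rfl rfl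
              rw [add_eq_zero_iff_of_zmod_two, eq_comm]
              exact ⟨fun he => Subtype.ext (hL x.2 y.2 he), fun he => by rw [he]⟩
      have hc' : ∑ c, (sgn (φ c) y : ℂ) * (sgn (φ c) x : ℂ) = if x = y then 2 ^ k else 0 := by
        exact_mod_cast hc
      simp only [Pi.smul_apply, Finset.sum_apply, smul_eq_mul, expo_eq_sgn, hc', Pi.single_apply]
      split_ifs
      · rw [inv_mul_cancel₀ (pow_ne_zero _ two_ne_zero)]
      · rw [mul_zero]
    rw [hdelta]
    refine Submodule.smul_mem _ _ (Submodule.sum_mem _ fun c _ => Submodule.smul_mem _ _ ?_)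
    exact Submodule.subset_span ⟨φ c, by simp, rfl⟩

/-! ### Assembling the cases. -/

theorem isSeparated_of_card_le_four {k : ℕ} {E : Finset (Z2 d)} (hk : k ≤ 2)
    (hE : E.card = 2 ^ k) : IsSeparated k E := by
  interval_cases k
  exacts [isSeparated_of_card_eq_one hE, isSeparated_of_card_eq_two hE,
    isSeparated_of_card_eq_four hE]

theorem isSpectral_iff_isTile {k : ℕ} {E : Finset (Z2 d)} (hE : E.card = 2 ^ k)
    (hk : k ≤ 3 ∨ d ≤ k + 2) : IsSpectral E ↔ IsTile E := by
  suffices h : (IsSpectral E → IsSeparated k E) ∧ (IsTile E → IsSeparated k E) from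
    ⟨fun hs => (h.1 hs).isTile hE, fun ht => (h.2 ht).isSpectral hE⟩
  have hkd : k ≤ d := by
    have h1 : E.card ≤ 2 ^ d := by simpa using E.card_le_univ
    exact (Nat.pow_le_pow_iff_right one_lt_two).1 (hE ▸ h1)
  by_cases h2 : k ≤ 2
  · exact ⟨fun _ => isSeparated_of_card_le_four h2 hE, fun _ => isSeparated_of_card_le_four h2 hE⟩
  by_cases h3 : k = 3
  · subst h3
    have h4 : 4 ∣ E.card := by rw [hE]; decide
    exact ⟨fun h => isSeparated_of_sum_notMem hE (sum_ne_of_isSpectral h4 h),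
      fun h => isSeparated_of_sum_notMem hE (sum_ne_of_isTile h4 h)⟩
  obtain h | h | h : d = k ∨ 1 + k = d ∨ 2 + k = d := by omega
  · subst h
    exact ⟨fun _ => isSeparated_self, fun _ => isSeparated_self⟩
  · exact ⟨isSeparated_of_isSpectral_index_two h hE, isSeparated_of_isTile_index_two h hE⟩
  · exact ⟨isSeparated_of_isSpectral_index_four h hE, isSeparated_of_isTile_index_four h hE⟩

end Fourier

theorem proposition3p1 (d : ℕ) (hd : d = 5 ∨ d = 6) (E : Finset (Z2 d))
    (hE : ∃ k : ℕ, E.card = 2 ^ k) : IsSpectral E ↔ IsTile E := by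
  obtain ⟨k, hk⟩ := hE
  -- Since `d ≤ 6`, any `k ≥ 4` satisfies `d ≤ k + 2`.
  exact isSpectral_iff_isTile hk (by omega)
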